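/- \textbf{Theorem (Control Theorem).} Let $\mathcal A$ be a nonempty countable alphabet with the discrete $\sigma$-algebra, and let $(S_t)_{t\in\mathbb Z}$ be a stationary process with values in $\mathcal A$, given by a probability measure $P$ on $\mathcal A^{\mathbb Z}$ with the cylinder $\sigma$-algebra. Write $\overleftarrow S=(\dots,S_{-2},S_{-1})$, $\overrightarrow S=(S_0,S_1,\dots)$ and $\overrightarrow S^{L}=(S_0,\dots,S_{L-1})$. Entropies are in bits and take values in $[0,\infty]$: $H[X]=-\sum_x P(X=x)\log_2P(X=x)$ if $X$ almost surely takes values in some countable set, and $H[X]=\infty$ otherwise. For $X$ with values in a countable set and an arbitrary random variable $Y$, $H[X\mid Y]$ is the mean over the values $y$ of $Y$ of the entropy of the conditional distribution $P(X=\cdot\mid Y=y)$. Let $H[S]=H[S_0]$ be the entropy of a single symbol. Two histories (semi-infinite pasts) are causally equivalent if they give the same (regular) conditional distribution of the future $\overrightarrow S$ given $\overleftarrow S$. The causal states are the equivalence classes, $\epsilon$ maps a history to its class, $\mathcal S=\epsilon(\overleftarrow S)$ is the current causal state, and $C_\mu=H[\mathcal S]$ is the statistical complexity of the process. A class of prescient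 rivals is given by a measurable map $\eta$ from histories to some measurable space of states such that, with $\mathcal R=\eta(\overleftarrow S)$, one has $H[\overrightarrow S^{L}\mid\mathcal R]=H[\overrightarrow S^{L}\mid\mathcal S]$ for all $L\ge1$. For every such class of prescient rivals, the conditional entropy rate $$h[\overrightarrow S\mid\mathcal R]=\lim_{L\to\infty}\frac1L H[\overrightarrow S^{L}\mid\mathcal R]$$ exists in $[0,\infty]$, it is finite if $H[S]$ is finite, and $$H[S]\le h[\overrightarrow S\mid\mathcal R]+C_\mu .$$ In particular, $H[S]-h[\overrightarrow S\mid\mathcal R]\le C_\mu$ whenever $H[S]<\infty$. -/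

import Mathlib

open scoped ENNReal

noncomputable section

namespace CompMech

open MeasureTheory ProbabilityTheory

/-! ### Entropies, in bits, with values in `[0, ∞]` -/

/-- The Shannon entropy `-∑ ν{b} log₂ ν{b}` (with `0 log 0 = 0`) of a distribution `ν` carried by
countably many points; the entropy of a distribution that is not carried by countably many points
is infinite.  On a countable type the first case always applies. -/
def lawEntropy {B : Type*} [MeasurableSpace B] (ν : Measure B) : ℝ≥0∞ :=
  open Classical in
  if ∃ C : Set B, C.Countable ∧ ν Cᶜ = 0 then
    ∑' b : B, ENNReal.ofReal (-(ν.real {b} * Real.logb 2 (ν.real {b})))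
  else ∞

/-- The entropy `H[X]` of a random variable. -/
def entropy {Ω B : Type*} [MeasurableSpace Ω] [MeasurableSpace B] (μ : Measure Ω) (X : Ω → B) :
    ℝ≥0∞ :=
  lawEntropy (μ.map X)

/-- The conditional entropy `H[X | Y]`: the mean over the values `y` of `Y` of the entropy of the
conditional distribution `Prob(X = · | Y = y)`.  The conditioning variable `Y` is arbitrary. -/
def condEntropy {Ω B C : Type*} [MeasurableSpace Ω] [MeasurableSpace B] [StandardBorelSpace B]
    [Nonempty B] [MeasurableSpace C] (μ : Measure Ω) [IsFiniteMeasure μ] (X : Ω → B) (Y : Ω → C) :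
    ℝ≥0∞ :=
  ∫⁻ y, lawEntropy (condDistrib X Y μ y) ∂(μ.map Y)

/-! ### Processes, pasts and futures

A process over the alphabet `A` is a probability measure on the space `ℤ → A` of bi-infinite
sequences, with the cylinder `σ`-algebra.  The present is time `0`. -/

variable {A : Type*}

/-- Histories, most recent symbol first: `x n` is the symbol at time `-(n + 1)`. -/
abbrev History (A : Type*) : Type _ := ℕ → A

/-- The semi-infinite past `… S₋₂ S₋₁` (not including the symbol at time `0`). -/
def past (ω : ℤ → A) : History A := fun n => ω (-((n : ℤ) + 1))

/-- The semi-infinite future `S₀ S₁ S₂ …`. -/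
def future (ω : ℤ → A) : ℕ → A := fun n => ω n

/-- The next `L` symbols `S₀ … S_{L-1}`. -/
def futureBlock (L : ℕ) (ω : ℤ → A) : Fin L → A := fun i => ω (i : ℕ)

variable [MeasurableSpace A]

/-- Stationarity: words of every length have the same probability at every time. -/
def IsStationary (P : Measure (ℤ → A)) : Prop :=
  ∀ (t : ℤ) (L : ℕ) (w : Fin L → A),
    P {ω | ∀ i : Fin L, ω (t + (i : ℕ)) = w i} = P {ω | ∀ i : Fin L, ω (i : ℕ) = w i}

/-- The entropy `H[S]` of a single symbol. -/
def symbolEntropy (P : Measure (ℤ → A)) : ℝ≥0∞ :=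
  entropy P (fun ω => ω 0)

variable [Countable A] [DiscreteMeasurableSpace A] [Nonempty A]

/-! ### Causal states -/

/-- Two histories are causally equivalent when they have the same morph, i.e. the same conditional
distribution `Prob(future | past = ·)` of semi-infinite futures. -/
def causalSetoid (P : Measure (ℤ → A)) [IsProbabilityMeasure P] : Setoid (History A) :=
  Setoid.ker (fun x : History A => condDistrib future past P x)

/-- The causal states of a process, with the quotient `σ`-algebra. -/
abbrev CausalState (P : Measure (ℤ → A)) [IsProbabilityMeasure P] : Type _ :=
  Quotient (causalSetoid P)

/-- The map `ε` from histories to causal states. -/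
def causalState (P : Measure (ℤ → A)) [IsProbabilityMeasure P] (x : History A) : CausalState P :=
  Quotient.mk (causalSetoid P) x

/-- The statistical complexity `C_μ` of a process: the entropy of its causal state. -/
def statComplexity (P : Measure (ℤ → A)) [IsProbabilityMeasure P] : ℝ≥0∞ :=
  entropy P (fun ω => causalState P (past ω))

/-! ### Effective states and prescient rivals

A class of effective states is given by a measurable map `η` from histories to state labels. -/

variable {R : Type*} [MeasurableSpace R]

/-- `H[next L symbols | effective state]`. -/
def blockCondEntropy (P : Measure (ℤ → A)) [IsProbabilityMeasure P] (η : History A → R) (L : ℕ) :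
    ℝ≥0∞ :=
  condEntropy P (futureBlock L) (fun ω => η (past ω))

/-- `η` gives prescient rivals of the causal states: for all `L ≥ 1`, they predict the next `L`
symbols as well as the causal states do. -/
def IsPrescientRival (P : Measure (ℤ → A)) [IsProbabilityMeasure P] (η : History A → R) : Prop :=
  Measurable η ∧ ∀ L : ℕ, 1 ≤ L → blockCondEntropy P η L = blockCondEntropy P (causalState P) L

/-- `h` is the conditional entropy rate `h[future | state] = lim_L H[next L symbols | state] / L`. -/
def IsCondEntropyRate (P : Measure (ℤ → A)) [IsProbabilityMeasure P] (η : History A → R)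
    (h : ℝ≥0∞) : Prop :=
  Filter.Tendsto (fun L : ℕ => blockCondEntropy P η L / (L : ℝ≥0∞)) Filter.atTop (nhds h)

end CompMech

end

/-! The causal state retains the whole predictive distribution, so conditioning the future on it is
the same as conditioning on the past. By stationarity and the chain rule, `L` symbols given the past
have entropy exactly `L * entropyRate P`, where `entropyRate P` is H[S₀ | past]
(`lintegral_plog_wordProb`, `blockCondEntropy_causalState`). Prescient rivals share these block
entropies, so their normalised sequence is constant for `L ≥ 1` and its limit is `entropyRate P`,
which is at most H[S] by Jensen's inequality.

The bound is H[S₀] ≤ H[S₀, 𝒮] = H[S₀ | 𝒮] + H[𝒮] (`symbolEntropy_le`). It is trivial unless 𝒮 is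
carried by a countable set, and then it is a computation with sums over atoms. No entropy is ever
subtracted, so infinite values need no separate treatment. -/

namespace CompMech

open MeasureTheory ProbabilityTheory

/-! ### The entropy function on `[0, ∞]` -/

/-- The function `p ↦ -p log₂ p`. -/
noncomputable def plog (p : ℝ≥0∞) : ℝ≥0∞ :=
  ENNReal.ofReal (-(p.toReal * Real.logb 2 p.toReal))

/-- The information content `p ↦ -log₂ p`, which is `0` at `p = 0` and for `p ≥ 1`. -/
noncomputable def surprisal (p : ℝ≥0∞) : ℝ≥0∞ :=
  ENNReal.ofReal (-Real.logb 2 p.toReal)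

lemma measurable_plog : Measurable plog := by
  unfold plog Real.logb
  fun_prop

lemma plog_zero : plog 0 = 0 := by simp [plog]

lemma plog_one : plog 1 = 0 := by simp [plog]

lemma plog_eq {p : ℝ≥0∞} (hp : p ≠ ∞) : plog p = p * surprisal p := by
  rw [plog, surprisal, ← mul_neg, ENNReal.ofReal_mul ENNReal.toReal_nonneg,
    ENNReal.ofReal_toReal hp]

/-- The hypothesis `p ≠ 0` is essential, because `surprisal 0 = 0` by convention. -/
lemma surprisal_anti {p q : ℝ≥0∞} (hp : p ≠ 0) (hq : q ≠ ∞) (hpq : p ≤ q) :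
    surprisal q ≤ surprisal p := by
  refine ENNReal.ofReal_le_ofReal (neg_le_neg ?_)
  exact Real.logb_le_logb_of_le one_lt_two
    (ENNReal.toReal_pos hp (ne_top_of_le_ne_top hq hpq)) (ENNReal.toReal_mono hq hpq)

lemma surprisal_mul {p q : ℝ≥0∞} (hp : p ≠ 0) (hq : q ≠ 0) (hp1 : p ≤ 1) (hq1 : q ≤ 1) :
    surprisal (p * q) = surprisal p + surprisal q := by
  have hp' := ENNReal.toReal_pos hp (ne_top_of_le_ne_top ENNReal.one_ne_top hp1)
  have hq' := ENNReal.toReal_pos hq (ne_top_of_le_ne_top ENNReal.one_ne_top hq1)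
  have key : ∀ r : ℝ≥0∞, r ≠ 0 → r ≤ 1 → 0 ≤ -Real.logb 2 r.toReal := fun r _ hr =>
    neg_nonneg.2 (Real.logb_nonpos one_lt_two ENNReal.toReal_nonneg
      (ENNReal.toReal_le_of_le_ofReal zero_le_one (by simpa using hr)))
  rw [surprisal, surprisal, surprisal, ← ENNReal.ofReal_add (key p hp hp1) (key q hq hq1),
    ENNReal.toReal_mul, Real.logb_mul hp'.ne' hq'.ne', neg_add]

/-- The pointwise form of the chain rule for entropy: a Leibniz rule that survives zero factors. The
bounds by `1` keep the logarithms nonpositive, where `ENNReal.ofReal` does not truncate. -/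
lemma plog_mul {p q : ℝ≥0∞} (hp1 : p ≤ 1) (hq1 : q ≤ 1) :
    plog (p * q) = p * plog q + q * plog p := by
  have hp : p ≠ ∞ := ne_top_of_le_ne_top ENNReal.one_ne_top hp1
  have hq : q ≠ ∞ := ne_top_of_le_ne_top ENNReal.one_ne_top hq1
  rcases eq_or_ne p 0 with rfl | hp0
  · simp [plog_zero]
  rcases eq_or_ne q 0 with rfl | hq0
  · simp [plog_zero]
  rw [plog_eq (ENNReal.mul_ne_top hp hq), surprisal_mul hp0 hq0 hp1 hq1, plog_eq hp, plog_eq hq]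
  ring

/-- Each term is at most the total, hence at least as surprising. Applied to a joint law, this says
that a marginal has no more entropy than the pair. -/
lemma plog_tsum_le {ι : Type*} (p : ι → ℝ≥0∞) (h : ∑' i, p i ≤ 1) :
    plog (∑' i, p i) ≤ ∑' i, plog (p i) := by
  have hS : ∑' i, p i ≠ ∞ := ne_top_of_le_ne_top ENNReal.one_ne_top h
  rw [plog_eq hS, ← ENNReal.tsum_mul_right]
  refine ENNReal.tsum_le_tsum fun i => ?_
  have hi : p i ≤ ∑' i, p i := ENNReal.le_tsum i
  rw [plog_eq (ne_top_of_le_ne_top hS hi)]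
  rcases eq_or_ne (p i) 0 with h0 | h0
  · simp [h0]
  · exact mul_le_mul_right (surprisal_anti h0 hS hi) _

lemma plog_eq_negMulLog (p : ℝ≥0∞) :
    plog p = ENNReal.ofReal (Real.negMulLog p.toReal / Real.log 2) := by
  rw [plog, Real.negMulLog, Real.logb]
  congr 1
  ring

/-- Jensen's inequality for `plog`. -/
lemma lintegral_plog_le {Ω : Type*} [MeasurableSpace Ω] (μ : Measure Ω) [IsProbabilityMeasure μ]
    {f : Ω → ℝ≥0∞} (hf : Measurable f) (hf1 : ∀ x, f x ≤ 1) :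
    ∫⁻ x, plog (f x) ∂μ ≤ plog (∫⁻ x, f x ∂μ) := by
  have h1 : ∀ x, (f x).toReal ≤ 1 := fun x =>
    ENNReal.toReal_le_of_le_ofReal zero_le_one (by simpa using hf1 x)
  have hlog : 0 < Real.log 2 := Real.log_pos one_lt_two
  have hnn : ∀ x, 0 ≤ Real.negMulLog (f x).toReal := fun x =>
    Real.negMulLog_nonneg ENNReal.toReal_nonneg (h1 x)
  have hfi : Integrable (fun x => (f x).toReal) μ :=
    Integrable.of_bound hf.ennreal_toReal.aestronglyMeasurable 1
      (.of_forall fun x => by simpa [abs_of_nonneg] using h1 x)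
  have hgi : Integrable (fun x => Real.negMulLog (f x).toReal) μ := by
    refine Integrable.of_bound
      (Real.continuous_negMulLog.measurable.comp hf.ennreal_toReal).aestronglyMeasurable 1
      (.of_forall fun x => ?_)
    rw [Real.norm_of_nonneg (hnn x)]
    have := Real.negMulLog_le_one_sub_self (x := (f x).toReal) ENNReal.toReal_nonneg
    linarith [ENNReal.toReal_nonneg (a := f x)]
  simp_rw [plog_eq_negMulLog]
  rw [← ofReal_integral_eq_lintegral_ofReal (hgi.div_const _)
    (.of_forall fun x => div_nonneg (hnn x) hlog.le)]
  refine ENNReal.ofReal_le_ofReal ?_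
  rw [integral_div]
  refine div_le_div_of_nonneg_right ?_ hlog.le
  rw [← integral_toReal hf.aemeasurable
    (.of_forall fun x => (hf1 x).trans_lt ENNReal.one_lt_top)]
  exact Real.concaveOn_negMulLog.le_map_integral Real.continuous_negMulLog.continuousOn
    isClosed_Ici (.of_forall fun x => ENNReal.toReal_nonneg) hfi hgi

lemma lawEntropy_of_countable {B : Type*} [MeasurableSpace B] {ν : Measure B}
    (h : ∃ C : Set B, C.Countable ∧ ν Cᶜ = 0) : lawEntropy ν = ∑' b : B, plog (ν {b}) := by
  rw [lawEntropy, if_pos h]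
  rfl

lemma lawEntropy_eq_tsum {B : Type*} [MeasurableSpace B] [Countable B] (ν : Measure B) :
    lawEntropy ν = ∑' b : B, plog (ν {b}) :=
  lawEntropy_of_countable ⟨Set.univ, Set.countable_univ, by simp⟩

/-! ### Words and cylinders -/

section Words

variable {A : Type*}

/-- The sequences that start with the word `w`. -/
def cyl {L : ℕ} (w : Fin L → A) : Set (ℕ → A) := {u | ∀ i : Fin L, u i = w i}

/-- The history one step later, when the symbol `a` has been observed. -/
def push (a : A) (x : History A) : History A := fun n => Nat.casesOn n a x

/-- The shift of bi-infinite sequences by one step. -/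
def shift (ω : ℤ → A) : ℤ → A := fun n => ω (n + 1)

lemma past_shift (ω : ℤ → A) : past (shift ω) = push (future ω 0) (past ω) := by
  funext n
  cases n with
  | zero => simp [past, shift, push, future]
  | succ n => simp [past, shift, push]

lemma future_shift (ω : ℤ → A) (n : ℕ) : future (shift ω) n = future ω (n + 1) := by
  simp [future, shift]

lemma future_mem_cyl_cons {L : ℕ} (ω : ℤ → A) (a : A) (w : Fin L → A) :
    future ω ∈ cyl (Fin.cons a w : Fin (L + 1) → A) ↔
      future ω 0 = a ∧ future (shift ω) ∈ cyl w := by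
  simp [cyl, Fin.forall_fin_succ, future_shift]

lemma push_zero (a : A) (x : History A) : push a x 0 = a := rfl

lemma push_tail (a : A) (x : History A) : (fun n => push a x (n + 1)) = x := rfl

variable [MeasurableSpace A]

lemma measurable_past : Measurable (past : (ℤ → A) → History A) := by
  unfold past; fun_prop

lemma measurable_future : Measurable (future : (ℤ → A) → ℕ → A) := by
  unfold future; fun_prop

lemma measurable_shift : Measurable (shift : (ℤ → A) → ℤ → A) := by
  unfold shift; fun_prop

lemma measurable_push : Measurable (fun z : A × History A => push z.1 z.2) := by
  refine measurable_pi_lambda _ fun n => ?_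
  cases n with
  | zero => exact measurable_fst
  | succ n => exact (measurable_pi_apply n).comp measurable_snd

variable [Countable A] [DiscreteMeasurableSpace A]

lemma measurableSet_cyl {L : ℕ} (w : Fin L → A) : MeasurableSet (cyl w) := by
  have : cyl w = ⋂ i : Fin L, (fun u : ℕ → A => u i) ⁻¹' {w i} := by
    ext u; simp [cyl]
  rw [this]
  exact .iInter fun i => measurable_pi_apply _ (measurableSet_singleton _)

lemma measurableSet_zero_eq (a : A) : MeasurableSet {u : ℕ → A | u 0 = a} :=
  (measurable_pi_apply (X := fun _ : ℕ => A) 0) (measurableSet_singleton a)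

/-- A finite measure on sequences is determined by the probabilities of words. -/
lemma ext_of_words {ι κ : Type*} {μ ν : Measure (ι → A)} [IsFiniteMeasure μ] {n : κ → ℕ}
    (e : ∀ k, Fin (n k) → ι) (he : ∀ I : Finset ι, ∃ k, ∀ i ∈ I, ∃ j, e k j = i)
    (h : ∀ k (w : Fin (n k) → A), μ {ω | ∀ i, ω (e k i) = w i} = ν {ω | ∀ i, ω (e k i) = w i}) :
    μ = ν := by
  have hblock : ∀ k, μ.map (fun ω i => ω (e k i)) = ν.map (fun ω i => ω (e k i)) := by
    intro k
    have hm : Measurable (fun (ω : ι → A) i => ω (e k i)) := by fun_prop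
    refine Measure.ext_of_singleton fun w => ?_
    rw [Measure.map_apply hm (measurableSet_singleton w),
      Measure.map_apply hm (measurableSet_singleton w)]
    have : (fun (ω : ι → A) i => ω (e k i)) ⁻¹' {w} = {ω | ∀ i, ω (e k i) = w i} := by
      ext ω; simp [funext_iff]
    rw [this, h]
  refine IsProjectiveLimit.unique (P := fun I : Finset ι => μ.map I.restrict)
    (fun I => rfl) (fun I => ?_)
  obtain ⟨k, hk⟩ := he I
  choose j hj using hk
  have hm : Measurable (fun (ω : ι → A) i => ω (e k i)) := by fun_prop
  let φ : (Fin (n k) → A) → I → A := fun w i => w (j i i.2)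
  have hφ : Measurable φ := by fun_prop
  have hr : (I.restrict : (ι → A) → I → A) = φ ∘ fun ω i => ω (e k i) := by
    funext ω i
    simp [φ, hj]
  change ν.map I.restrict = μ.map I.restrict
  rw [hr, ← Measure.map_map hφ hm, ← Measure.map_map hφ hm, hblock]

lemma ext_of_cyl {μ ν : Measure (ℕ → A)} [IsFiniteMeasure μ]
    (h : ∀ (L : ℕ) (w : Fin L → A), μ (cyl w) = ν (cyl w)) : μ = ν := by
  refine ext_of_words (n := id) (fun L i => (i : ℕ)) (fun I => ⟨I.sup id + 1, fun i hi => ?_⟩) h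
  exact ⟨⟨i, Nat.lt_succ_of_le (Finset.le_sup (f := id) hi)⟩, rfl⟩

lemma IsStationary.map_shift {P : Measure (ℤ → A)} [IsProbabilityMeasure P]
    (hP : IsStationary P) : P.map shift = P := by
  have : IsProbabilityMeasure (P.map shift) :=
    Measure.isProbabilityMeasure_map measurable_shift.aemeasurable
  -- The windows are `-k, …, k`, which exhaust `ℤ`.
  refine ext_of_words (n := fun k : ℕ => 2 * k + 1) (fun k i => -(k : ℤ) + (i : ℕ))
    (fun I => ⟨I.sup Int.natAbs, fun i hi => ?_⟩) fun k w => ?_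
  · have hle : i.natAbs ≤ I.sup Int.natAbs := Finset.le_sup hi
    refine ⟨⟨(i + (I.sup Int.natAbs : ℕ)).toNat, by omega⟩, ?_⟩
    simp only
    omega
  · have hms : MeasurableSet {ω : ℤ → A | ∀ i : Fin (2 * k + 1), ω (-(k : ℤ) + (i : ℕ)) = w i} := by
      have : {ω : ℤ → A | ∀ i : Fin (2 * k + 1), ω (-(k : ℤ) + (i : ℕ)) = w i}
          = ⋂ i : Fin (2 * k + 1), (fun ω : ℤ → A => ω (-(k : ℤ) + (i : ℕ))) ⁻¹' {w i} := by
        ext u; simp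
      rw [this]
      exact .iInter fun i => measurable_pi_apply _ (measurableSet_singleton _)
    rw [Measure.map_apply measurable_shift hms, hP (-(k : ℤ)), ← hP (-(k : ℤ) + 1)]
    congr 1
    ext ω
    simp only [Set.mem_preimage, Set.mem_ofPred_eq, shift]
    refine forall_congr' fun i => ?_
    rw [add_right_comm]

lemma IsStationary.lintegral_shift {P : Measure (ℤ → A)} [IsProbabilityMeasure P]
    (hP : IsStationary P) {f : (ℤ → A) → ℝ≥0∞} (hf : Measurable f) :
    ∫⁻ ω, f (shift ω) ∂P = ∫⁻ ω, f ω ∂P := by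
  rw [← lintegral_map hf measurable_shift, hP.map_shift]

end Words

/-! ### The predictive distribution -/

section Predict

variable {A : Type*} [MeasurableSpace A] [Countable A] [DiscreteMeasurableSpace A] [Nonempty A]
  (P : Measure (ℤ → A)) [IsProbabilityMeasure P]

lemma lintegral_past_future {f : History A × (ℕ → A) → ℝ≥0∞} (hf : Measurable f) :
    ∫⁻ x, ∫⁻ u, f (x, u) ∂(condDistrib future past P x) ∂(P.map past) =
      ∫⁻ ω, f (past ω, future ω) ∂P := by
  rw [← Measure.lintegral_compProd hf, compProd_map_condDistrib measurable_future.aemeasurable,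
    lintegral_map hf (measurable_past.prodMk measurable_future)]

/-- The probability of the next word, given the past. -/
noncomputable def wordProb {L : ℕ} (w : Fin L → A) (x : History A) : ℝ≥0∞ :=
  condDistrib future past P x (cyl w)

/-- The probability of the next symbol, given the past. -/
noncomputable def symbolProb (a : A) (x : History A) : ℝ≥0∞ :=
  condDistrib future past P x {u | u 0 = a}

lemma measurable_wordProb {L : ℕ} (w : Fin L → A) : Measurable (wordProb P w) :=
  Kernel.measurable_coe _ (measurableSet_cyl w)

lemma measurable_symbolProb (a : A) : Measurable (symbolProb P a) :=
  Kernel.measurable_coe _ (measurableSet_zero_eq a)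

lemma wordProb_le_one {L : ℕ} (w : Fin L → A) (x : History A) : wordProb P w x ≤ 1 := prob_le_one

lemma symbolProb_le_one (a : A) (x : History A) : symbolProb P a x ≤ 1 := prob_le_one

lemma lintegral_head (x : History A) (f : A → ℝ≥0∞) :
    ∫⁻ u, f (u 0) ∂(condDistrib future past P x) = ∑' a, f a * symbolProb P a x := by
  have h0 : Measurable (fun u : ℕ → A => u 0) := measurable_pi_apply 0
  rw [← lintegral_map (f := f) (Measurable.of_discrete) h0, lintegral_countable']
  refine tsum_congr fun a => ?_
  rw [Measure.map_apply h0 (measurableSet_singleton a)]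
  rfl

lemma tsum_wordProb (L : ℕ) (x : History A) : ∑' w : Fin L → A, wordProb P w x = 1 := by
  have hm : Measurable (fun (u : ℕ → A) (i : Fin L) => u i) := by fun_prop
  have := lintegral_countable'
    (μ := (condDistrib future past P x).map (fun (u : ℕ → A) (i : Fin L) => u i)) (fun _ => 1)
  have hp := Measure.isProbabilityMeasure_map (μ := condDistrib future past P x) hm.aemeasurable
  rw [lintegral_one, measure_univ] at this
  rw [this]
  refine tsum_congr fun w => ?_
  rw [one_mul, Measure.map_apply hm (measurableSet_singleton w), wordProb]
  congr 1
  ext u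
  simp [cyl, funext_iff]

lemma tsum_symbolProb (x : History A) : ∑' a, symbolProb P a x = 1 := by
  simpa using (lintegral_head P x fun _ => 1).symm

/-- The defining property of conditional probability, with a weight depending only on the past. -/
lemma lintegral_mul_condDistrib {S : Set (ℕ → A)} (hS : MeasurableSet S)
    {f : History A → ℝ≥0∞} (hf : Measurable f) :
    ∫⁻ ω, f (past ω) * condDistrib future past P (past ω) S ∂P =
      ∫⁻ ω, f (past ω) * S.indicator 1 (future ω) ∂P := by
  have hc : Measurable (S.indicator (1 : (ℕ → A) → ℝ≥0∞)) := measurable_one.indicator hS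
  rw [← lintegral_past_future P (f := fun z => f z.1 * S.indicator 1 z.2)
      ((hf.comp measurable_fst).mul (hc.comp measurable_snd)),
    ← lintegral_map (f := fun x => f x * condDistrib future past P x S)
      (hf.mul (Kernel.measurable_coe _ hS)) measurable_past]
  refine lintegral_congr fun x => ?_
  dsimp only
  rw [lintegral_const_mul _ hc, lintegral_indicator_one hS]

/-- The event that the past lies in `B` and the next symbol is `a` concerns only the past of the
shifted sequence. Hence, once stationarity has moved the origin, `w` may be conditioned on that
longer past; a second shift moves back. There are countably many triples `L`, `a`, `w`, so one null
set serves for all. -/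
lemma wordProb_cons_ae (hP : IsStationary P) :
    ∀ᵐ x ∂(P.map past), ∀ (L : ℕ) (a : A) (w : Fin L → A),
      wordProb P (Fin.cons a w : Fin (L + 1) → A) x =
        symbolProb P a x * wordProb P w (push a x) := by
  rw [ae_all_iff]; intro L
  rw [ae_all_iff]; intro a
  rw [ae_all_iff]; intro w
  have hprob : IsProbabilityMeasure (P.map past) :=
    Measure.isProbabilityMeasure_map measurable_past.aemeasurable
  have hpush : Measurable (push a : History A → History A) :=
    measurable_push.comp (measurable_const.prodMk measurable_id)
  have hwa : Measurable fun x => wordProb P w (push a x) := (measurable_wordProb P w).comp hpush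
  refine ae_eq_of_forall_setLIntegral_eq_of_sigmaFinite (measurable_wordProb P _)
    ((measurable_symbolProb P a).mul hwa) fun B hB _ => ?_
  have hB1 : Measurable (B.indicator (1 : History A → ℝ≥0∞)) := measurable_one.indicator hB
  have ha1 : Measurable (({a} : Set A).indicator (1 : A → ℝ≥0∞)) :=
    measurable_one.indicator (measurableSet_singleton a)
  -- the history `x` ends in `a`, and `B` contains the history before that
  let G : History A → ℝ≥0∞ := fun x =>
    B.indicator 1 (fun n => x (n + 1)) * ({a} : Set A).indicator 1 (x 0)
  have hG : Measurable G := by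
    refine (hB1.comp ?_).mul (ha1.comp (measurable_pi_apply 0))
    fun_prop
  have hset : ∀ f : History A → ℝ≥0∞, Measurable f →
      ∫⁻ x in B, f x ∂(P.map past) = ∫⁻ ω, B.indicator 1 (past ω) * f (past ω) ∂P := by
    intro f hf
    rw [← lintegral_indicator hB, lintegral_map (hf.indicator hB) measurable_past]
    refine lintegral_congr fun ω => ?_
    by_cases h : past ω ∈ B <;> simp [h]
  have hGs : ∀ ω, G (past (shift ω)) =
      B.indicator 1 (past ω) * ({a} : Set A).indicator 1 (future ω 0) := by
    intro ω
    simp only [G, past_shift, push_tail, push_zero]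
  calc ∫⁻ x in B, wordProb P (Fin.cons a w : Fin (L + 1) → A) x ∂(P.map past)
      = ∫⁻ ω, B.indicator 1 (past ω) *
          (cyl (Fin.cons a w : Fin (L + 1) → A)).indicator 1 (future ω) ∂P := by
        rw [hset _ (measurable_wordProb P _)]
        exact lintegral_mul_condDistrib P (measurableSet_cyl _) hB1
    _ = ∫⁻ ω, G (past (shift ω)) * (cyl w).indicator 1 (future (shift ω)) ∂P := by
        refine lintegral_congr fun ω => ?_
        rw [hGs, mul_assoc]
        congr 1
        by_cases h1 : future ω 0 = a <;> by_cases h2 : future (shift ω) ∈ cyl w <;>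
          simp [future_mem_cyl_cons, h1, h2]
    _ = ∫⁻ ω, G (past ω) * (cyl w).indicator 1 (future ω) ∂P :=
        hP.lintegral_shift (f := fun ω => G (past ω) * (cyl w).indicator 1 (future ω))
          ((hG.comp measurable_past).mul
            ((measurable_one.indicator (measurableSet_cyl w)).comp measurable_future))
    _ = ∫⁻ ω, G (past ω) * wordProb P w (past ω) ∂P := 
        (lintegral_mul_condDistrib P (measurableSet_cyl w) hG).symm
    _ = ∫⁻ ω, G (past (shift ω)) * wordProb P w (past (shift ω)) ∂P :=
        (hP.lintegral_shift (f := fun ω => G (past ω) * wordProb P w (past ω))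
          ((hG.mul (measurable_wordProb P w)).comp measurable_past)).symm
    _ = ∫⁻ ω, B.indicator 1 (past ω) * wordProb P w (push a (past ω)) *
          ({a} : Set A).indicator 1 (future ω 0) ∂P := by
        refine lintegral_congr fun ω => ?_
        rw [hGs, past_shift]
        by_cases h1 : future ω 0 = a
        · simp [h1]
        · simp [h1]
    _ = ∫⁻ x in B, symbolProb P a x * wordProb P w (push a x) ∂(P.map past) := by
        rw [hset (fun x => symbolProb P a x * wordProb P w (push a x))
          ((measurable_symbolProb P a).mul hwa)]
        -- For fixed `a` the remaining factors depend on the past alone, so the indicator of the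
        -- next symbol averages to `symbolProb`.
        have := lintegral_mul_condDistrib P (measurableSet_zero_eq a) (hB1.mul hwa)
        simp only [Pi.mul_apply] at this
        refine Eq.trans ?_ (this.symm.trans ?_)
        · rfl
        · refine lintegral_congr fun ω => ?_
          rw [symbolProb]
          ring

end Predict

/-! ### Block entropies given the past -/

section Blocks

variable {A : Type*} [MeasurableSpace A] [Countable A] [DiscreteMeasurableSpace A] [Nonempty A]
  (P : Measure (ℤ → A)) [IsProbabilityMeasure P]

/-- The conditional entropy of the next symbol, given the past. -/
noncomputable def entropyRate : ℝ≥0∞ := ∫⁻ x, ∑' a, plog (symbolProb P a x) ∂(P.map past)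

lemma measurable_tsum_plog_wordProb (L : ℕ) :
    Measurable fun x => ∑' w : Fin L → A, plog (wordProb P w x) :=
  .tsum fun w => measurable_plog.comp (measurable_wordProb P w)

lemma measurable_tsum_plog_symbolProb : Measurable fun x => ∑' a, plog (symbolProb P a x) :=
  .tsum fun a => measurable_plog.comp (measurable_symbolProb P a)

/-- The Leibniz rule `plog_mul` summed over words; the word probabilities after `a` sum to `1`,
leaving the entropy of the first symbol. -/
lemma tsum_plog_wordProb_cons {L : ℕ} {x : History A}
    (hx : ∀ (a : A) (w : Fin L → A), wordProb P (Fin.cons a w : Fin (L + 1) → A) x =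
      symbolProb P a x * wordProb P w (push a x)) :
    ∑' w : Fin (L + 1) → A, plog (wordProb P w x) =
      ∑' a, (∑' w : Fin L → A, plog (wordProb P w (push a x))) * symbolProb P a x +
        ∑' a, plog (symbolProb P a x) := by
  rw [← (Fin.consEquiv fun _ => A).tsum_eq, ENNReal.tsum_prod', ← ENNReal.tsum_add]
  refine tsum_congr fun a => ?_
  have : ∀ w : Fin L → A, plog (wordProb P (Fin.consEquiv (fun _ => A) (a, w)) x) =
      symbolProb P a x * plog (wordProb P w (push a x)) +
        wordProb P w (push a x) * plog (symbolProb P a x) := fun w => by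
    rw [← plog_mul (symbolProb_le_one P a x) (wordProb_le_one P w _), ← hx]
    rfl
  simp_rw [this]
  rw [ENNReal.tsum_add, ENNReal.tsum_mul_left, ENNReal.tsum_mul_right, tsum_wordProb, one_mul,
    mul_comm]

/-- Chain rule: given the past, the next `L` symbols have `L` times the entropy of one symbol. -/
lemma lintegral_plog_wordProb (hP : IsStationary P) (L : ℕ) :
    ∫⁻ x, ∑' w : Fin L → A, plog (wordProb P w x) ∂(P.map past) = L * entropyRate P := by
  have hprob : IsProbabilityMeasure (P.map past) :=
    Measure.isProbabilityMeasure_map measurable_past.aemeasurable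
  induction L with
  | zero =>
    have (x : History A) : wordProb P (default : Fin 0 → A) x = 1 := by
      simpa using tsum_wordProb P 0 x
    simp [this, plog_one, Subsingleton.elim _ (default : Fin 0 → A)]
  | succ L ih =>
    have hH := measurable_tsum_plog_wordProb P L
    have hf : Measurable fun z : History A × (ℕ → A) =>
        ∑' w : Fin L → A, plog (wordProb P w (push (z.2 0) z.1)) :=
      hH.comp (measurable_push.comp
        (((measurable_pi_apply (X := fun _ : ℕ => A) 0).comp measurable_snd).prodMk measurable_fst))
    calc ∫⁻ x, ∑' w : Fin (L + 1) → A, plog (wordProb P w x) ∂(P.map past)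
        = ∫⁻ x, (∫⁻ u, ∑' w : Fin L → A, plog (wordProb P w (push (u 0) x))
            ∂(condDistrib future past P x) + ∑' a, plog (symbolProb P a x)) ∂(P.map past) := by
          refine lintegral_congr_ae ?_
          filter_upwards [wordProb_cons_ae P hP] with x hx
          rw [tsum_plog_wordProb_cons P (hx L), ← lintegral_head P x
            fun a => ∑' w : Fin L → A, plog (wordProb P w (push a x))]
      -- Averaging over the past and the next symbol gives the law of the past at time `1`, which
      -- stationarity then identifies with the law at time `0`.
      _ = ∫⁻ ω, ∑' w : Fin L → A, plog (wordProb P w (past (shift ω))) ∂P + entropyRate P := by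
          rw [lintegral_add_right _ (measurable_tsum_plog_symbolProb P), entropyRate,
            lintegral_past_future P hf]
          simp_rw [past_shift]
      _ = L * entropyRate P + entropyRate P := by
          rw [hP.lintegral_shift (f := fun ω => ∑' w : Fin L → A, plog (wordProb P w (past ω)))
            (hH.comp measurable_past), ← ih, lintegral_map hH measurable_past]
      _ = (L + 1 : ℕ) * entropyRate P := by push_cast; ring

end Blocks

lemma symbolEntropy_eq {A : Type*} [MeasurableSpace A] [Countable A] [DiscreteMeasurableSpace A]
    (P : Measure (ℤ → A)) : symbolEntropy P = ∑' a, plog (P {ω | ω 0 = a}) := by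
  rw [symbolEntropy, entropy, lawEntropy_eq_tsum]
  refine tsum_congr fun a => ?_
  rw [Measure.map_apply (measurable_pi_apply 0) (measurableSet_singleton a)]
  rfl

/-! ### Causal states -/

section Causal

variable {A : Type*} [MeasurableSpace A] [Countable A] [DiscreteMeasurableSpace A] [Nonempty A]
  (P : Measure (ℤ → A)) [IsProbabilityMeasure P]

lemma measurable_causalState : Measurable (causalState P) := fun _ h => h

/-- The predictive distribution, as a function of the causal state. -/
noncomputable def stateKernel : Kernel (CausalState P) (ℕ → A) where
  toFun := Quotient.lift (fun x => condDistrib future past P x) fun _ _ h => h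
  measurable' := measurable_from_quotient.2 (condDistrib future past P).measurable

instance : IsMarkovKernel (stateKernel P) where
  isProbabilityMeasure s := by
    induction s using Quotient.inductionOn with
    | h x => exact inferInstanceAs (IsProbabilityMeasure (condDistrib future past P x))

lemma map_causalState_past :
    P.map (fun ω => causalState P (past ω)) = (P.map past).map (causalState P) :=
  (Measure.map_map (measurable_causalState P) measurable_past).symm

/-- The predictive distribution depends on the past only through its class, so the disintegration
over pasts descends to causal states. Almost sure uniqueness then identifies the conditional
distributions given the state. -/
lemma map_causalState_future :
    P.map (fun ω => (causalState P (past ω), future ω)) =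
      P.map (fun ω => causalState P (past ω)) ⊗ₘ stateKernel P := by
  have hs : Measurable fun ω => causalState P (past ω) :=
    (measurable_causalState P).comp measurable_past
  have : IsProbabilityMeasure (P.map fun ω => causalState P (past ω)) :=
    Measure.isProbabilityMeasure_map hs.aemeasurable
  refine Measure.ext_of_lintegral _ fun f hf => ?_
  rw [Measure.lintegral_compProd hf, lintegral_map hf (hs.prodMk measurable_future),
    map_causalState_past, lintegral_map hf.lintegral_kernel_prod_right' (measurable_causalState P)]
  exact (lintegral_past_future P (f := fun z => f (causalState P z.1, z.2))
    (hf.comp (((measurable_causalState P).comp measurable_fst).prodMk measurable_snd))).symm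

lemma condDistrib_futureBlock_ae (L : ℕ) :
    condDistrib (futureBlock L) (fun ω => causalState P (past ω)) P
      =ᵐ[P.map fun ω => causalState P (past ω)]
      (stateKernel P).map fun (u : ℕ → A) (i : Fin L) => u i := by
  have hs : Measurable fun ω => causalState P (past ω) :=
    (measurable_causalState P).comp measurable_past
  have hm : Measurable fun (u : ℕ → A) (i : Fin L) => u i := by fun_prop
  have : IsMarkovKernel ((stateKernel P).map fun (u : ℕ → A) (i : Fin L) => u i) :=
    Kernel.IsMarkovKernel.map _ hm
  have h1 := condDistrib_ae_eq_of_measure_eq_compProd (μ := P)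
    (fun ω => causalState P (past ω)) measurable_future.aemeasurable (map_causalState_future P)
  have h2 := condDistrib_comp (mβ := inferInstance) (μ := P) (fun ω => causalState P (past ω))
    measurable_future.aemeasurable hm
  filter_upwards [h1, h2] with s h1 h2
  rw [Kernel.map_apply _ hm, ← h1, ← Kernel.map_apply _ hm, ← h2]
  rfl

lemma blockCondEntropy_causalState (hP : IsStationary P) (L : ℕ) :
    blockCondEntropy P (causalState P) L = L * entropyRate P := by
  have hm : Measurable fun (u : ℕ → A) (i : Fin L) => u i := by fun_prop
  have hword : ∀ s, lawEntropy ((stateKernel P).map (fun (u : ℕ → A) (i : Fin L) => u i) s) =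
      ∑' w : Fin L → A, plog (stateKernel P s (cyl w)) := fun s => by
    rw [lawEntropy_eq_tsum]
    refine tsum_congr fun w => ?_
    rw [Kernel.map_apply _ hm, Measure.map_apply hm (measurableSet_singleton w)]
    congr 2
    ext u
    simp [cyl, funext_iff]
  rw [← lintegral_plog_wordProb P hP, blockCondEntropy, condEntropy]
  calc ∫⁻ s, lawEntropy (condDistrib (futureBlock L) (fun ω => causalState P (past ω)) P s)
        ∂(P.map fun ω => causalState P (past ω))
      = ∫⁻ s, ∑' w : Fin L → A, plog (stateKernel P s (cyl w))
        ∂(P.map fun ω => causalState P (past ω)) := by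
        refine lintegral_congr_ae ?_
        filter_upwards [condDistrib_futureBlock_ae P L] with s hs
        rw [hs, hword]
    _ = ∫⁻ x, ∑' w : Fin L → A, plog (wordProb P w x) ∂(P.map past) := by
        rw [map_causalState_past, lintegral_map _ (measurable_causalState P)]
        · rfl
        · exact .tsum fun w => measurable_plog.comp
            (Kernel.measurable_coe _ (measurableSet_cyl w))

/-- Countably many measurable functions, the word probabilities, separate causal states. This allows
integrals over a countable set of states to be written as sums over atoms. -/
instance : MeasurableSingletonClass (CausalState P) where
  measurableSet_singleton s := by
    have : ({s} : Set (CausalState P)) =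
        ⋂ (L : ℕ) (w : Fin L → A), (fun t => stateKernel P t (cyl w)) ⁻¹'
          {stateKernel P s (cyl w)} := by
      ext t
      simp only [Set.mem_singleton_iff, Set.mem_iInter, Set.mem_preimage]
      refine ⟨fun h => h ▸ fun _ _ => rfl, fun h => ?_⟩
      have heq := ext_of_cyl h
      induction s using Quotient.inductionOn with
      | h y =>
        induction t using Quotient.inductionOn with
        | h x => exact Quotient.sound heq
    rw [this]
    exact .iInter fun L => .iInter fun w =>
      Kernel.measurable_coe _ (measurableSet_cyl w) (measurableSet_singleton _)

/-! ### One symbol -/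

lemma measure_zero_eq (a : A) : P {ω | ω 0 = a} = ∫⁻ x, symbolProb P a x ∂(P.map past) := by
  have h := lintegral_mul_condDistrib P (measurableSet_zero_eq a) (f := fun _ => 1)
    measurable_const
  simp only [one_mul] at h
  have hm : MeasurableSet {ω : ℤ → A | ω 0 = a} :=
    (measurable_pi_apply (X := fun _ : ℤ => A) 0) (measurableSet_singleton a)
  rw [lintegral_map (measurable_symbolProb P a) measurable_past]
  refine Eq.trans ?_ h.symm
  rw [← lintegral_indicator_one hm]
  rfl

/-- Conditioning on the past does not increase the entropy of a symbol. -/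
lemma entropyRate_le_symbolEntropy : entropyRate P ≤ symbolEntropy P := by
  have hprob : IsProbabilityMeasure (P.map past) :=
    Measure.isProbabilityMeasure_map measurable_past.aemeasurable
  have hm : ∀ a, AEMeasurable (fun x => plog (symbolProb P a x)) (P.map past) := fun a =>
    (measurable_plog.comp (measurable_symbolProb P a)).aemeasurable
  rw [entropyRate, symbolEntropy_eq, lintegral_tsum hm]
  refine ENNReal.tsum_le_tsum fun a => ?_
  rw [measure_zero_eq]
  exact lintegral_plog_le _ (measurable_symbolProb P a) (symbolProb_le_one P a)

/-- The causal state and the next symbol given the causal state determine the next symbol. -/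
lemma symbolEntropy_le : symbolEntropy P ≤ entropyRate P + statComplexity P := by
  rw [statComplexity, entropy]
  set ν := P.map (fun ω => causalState P (past ω)) with hν
  have hνP : IsProbabilityMeasure ν :=
    Measure.isProbabilityMeasure_map ((measurable_causalState P).comp measurable_past).aemeasurable
  by_cases hC : ∃ C : Set (CausalState P), C.Countable ∧ ν Cᶜ = 0
  swap
  · rw [lawEntropy, if_neg hC, add_top]
    exact le_top
  rw [lawEntropy_of_countable hC]
  obtain ⟨C, hC, hC0⟩ := hC
  let q : A → CausalState P → ℝ≥0∞ := fun a s => stateKernel P s {u | u 0 = a}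
  have hq : ∀ a, Measurable (q a) := fun a => Kernel.measurable_coe _ (measurableSet_zero_eq a)
  -- Since `ν` is carried by the countable set `C`, averages over pasts of functions of the causal
  -- state are sums over `C`.
  have hint : ∀ f : CausalState P → ℝ≥0∞, Measurable f →
      ∫⁻ x, f (causalState P x) ∂(P.map past) = ∑' s : C, f s * ν {(s : CausalState P)} := by
    intro f hf
    rw [← lintegral_map hf (measurable_causalState P), ← map_causalState_past, ← hν,
      ← lintegral_countable f hC,
      Measure.restrict_eq_self_of_ae_mem (mem_ae_iff.2 hC0)]
  have hq1 : ∀ s : CausalState P, ∑' a, q a s = 1 := by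
    intro s
    induction s using Quotient.inductionOn with
    | h x => exact tsum_symbolProb P x
  have hsym : ∀ a, P {ω | ω 0 = a} = ∑' s : C, q a s * ν {(s : CausalState P)} := fun a => by
    rw [measure_zero_eq, ← hint (q a) (hq a)]
    rfl
  have hrate : entropyRate P =
      ∑' s : C, (∑' a, plog (q a s)) * ν {(s : CausalState P)} := by
    rw [← hint (fun s => ∑' a, plog (q a s)) (.tsum fun a => measurable_plog.comp (hq a))]
    rfl
  rw [symbolEntropy_eq]
  -- The inequality passes from the symbol to the pair (symbol, state); the next step is the chain
  -- rule for that pair.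
  calc ∑' a, plog (P {ω | ω 0 = a})
      ≤ ∑' a, ∑' s : C, plog (q a s * ν {(s : CausalState P)}) := by
        refine ENNReal.tsum_le_tsum fun a => ?_
        rw [hsym]
        exact plog_tsum_le _ (hsym a ▸ prob_le_one)
    _ = ∑' s : C, ((∑' a, plog (q a s)) * ν {(s : CausalState P)} +
          plog (ν {(s : CausalState P)})) := by
        rw [ENNReal.tsum_comm]
        refine tsum_congr fun s => ?_
        have : ∀ a, plog (q a s * ν {(s : CausalState P)}) =
            q a s * plog (ν {(s : CausalState P)}) + ν {(s : CausalState P)} * plog (q a s) :=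
          fun a => plog_mul prob_le_one prob_le_one
        simp_rw [this]
        rw [ENNReal.tsum_add, ENNReal.tsum_mul_right, ENNReal.tsum_mul_left, hq1, one_mul,
          add_comm, mul_comm]
    _ = entropyRate P + ∑' s : C, plog (ν {(s : CausalState P)}) := by
        rw [ENNReal.tsum_add, hrate]
    _ ≤ entropyRate P + ∑' s, plog (ν {s}) :=
        add_le_add_right (ENNReal.tsum_comp_le_tsum_of_injective Subtype.val_injective _) _

end Causal

end CompMech

theorem mainTheorem8 {A : Type*} [Countable A] [Nonempty A] [MeasurableSpace A]
    [DiscreteMeasurableSpace A] (P : MeasureTheory.Measure (ℤ → A))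
    [MeasureTheory.IsProbabilityMeasure P] (hP : CompMech.IsStationary P)
    {R : Type*} [MeasurableSpace R] (η : CompMech.History A → R)
    (hη : CompMech.IsPrescientRival P η) :
    ∃ h : ℝ≥0∞, CompMech.IsCondEntropyRate P η h ∧
      (CompMech.symbolEntropy P ≠ ∞ → h ≠ ∞) ∧
      CompMech.symbolEntropy P ≤ h + CompMech.statComplexity P := by
  refine ⟨CompMech.entropyRate P, ?_,
    fun h => ne_top_of_le_ne_top h (CompMech.entropyRate_le_symbolEntropy P),
    CompMech.symbolEntropy_le P⟩
  refine tendsto_const_nhds.congr' ?_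
  -- The case `L = 0` is left out: prescience says nothing there, and the quotient is degenerate.
  filter_upwards [Filter.eventually_ge_atTop 1] with L hL
  rw [hη.2 L hL, CompMech.blockCondEntropy_causalState P hP, mul_comm,
    ENNReal.mul_div_cancel_right (Nat.cast_ne_zero.2 (by omega)) (ENNReal.natCast_ne_top L)]
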